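/- Let $F(h,s)=\log_2(1+h^2s)$. Consider two-user Gaussian networks with unit noise power whose channel $h(t)=(h_1(t),h_2(t))$, $t=0,1,2,\dots$, is a stationary ergodic process of nonnegative gains. A broadcast (BC) network has a peak power $\tilde P\ge 0$ and a finite set $\mathcal R\ni 0$ of nonnegative codebook rates. At gains $(h_1,h_2)$ it supports $(r_1,r_2)\in\mathcal R^2$ if there are $p_1,p_2\ge 0$ with $p_1+p_2\le\tilde P$ such that, when $h_1>h_2$, $r_1\le F(h_1,p_1)$ and $r_2\le F\big(h_2,\tfrac{p_2}{1+h_2^2p_1}\big)$, and, when $h_1\le h_2$, $r_2\le F(h_2,p_2)$ and $r_1\le F\big(h_1,\tfrac{p_1}{1+h_1^2p_2}\big)$. A multiple access (MAC) network has peak powers $\tilde P_1,\tilde P_2\ge0$ and finite sets $\mathcal R_1,\mathcal R_2\ni0$ of nonnegative codebook rates. At gains $(h_1,h_2)$ it supports $(r_1,r_2)\in\mathcal R_1\times\mathcal R_2$ if there are $p_1\in[0,\tilde P_1]$, $p_2\in[0,\tilde P_2]$ for which successive decoding succeeds in one of the two orders, i.e. either $r_1\le F\big(h_1,\tfrac{p_1}{1+h_2^2p_2}\big)$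 and $r_2\le F(h_2,p_2)$, or $r_2\le F\big(h_2,\tfrac{p_2}{1+h_1^2p_1}\big)$ and $r_1\le F(h_1,p_1)$. The MAC network is dual to the BC network if $\tilde P_1+\tilde P_2=\tilde P$, the channel processes have the same law, and $\mathcal R_1=\mathcal R_2=\mathcal R$. The stability region of a network is the set of all average departure rate vectors $\lim_{T\to\infty}\frac1T\sum_{t<T}\mathbb E[r(t)]$ that are achieved, with infinitely backlogged nodes, by causal (possibly randomized) scheduling policies transmitting in every slot $t$ a rate vector $r(t)$ that is supported at the gains $h(t)$. Theorem 2. Let $U(B)$ denote the union of the stability regions of all MAC networks dual to a BC network $B$, and $\Gamma(B)$ the stability region of $B$. 1. If a MAC network is dual to $B$, then at all gains $h_1,h_2\ge0$ every rate vector supported by the MAC network is supported by $B$. 2. $U(B)\subseteq\Gamma(B)$ for every BC network $B$. 3. The inclusion is strict, $U(B)\subsetneq\Gamma(B)$, whenever $\tilde P>0$, $\mathcal R$ contains a positive rate, and the gains $h_1(t),h_2(t)$ are independent Rayleigh variables; more generally, whenever $\tilde P>0$, $\mathcal R$ contains a positive rate, and the distribution of $(h_1(t),h_2(t))$ gives positive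 probability to every nonempty open subset of $(0,\infty)^2$. 4. Let $0\le b<a$, $\tilde P>0$ and $R_0=\log_2(1+a^2\tilde P)$. There are BC networks with peak power $\tilde P$ and $\mathcal R=\{0,R_0\}$ whose gains are $(a,b)$ or $(b,a)$ with probability $\frac12$ each. For every such network $B$, $$\Gamma(B)=\big[0,\tfrac{R_0}{2}\big]^2,\qquad U(B)=\big(\big[0,\tfrac{R_0}{2}\big]\times\{0\}\big)\cup\big(\{0\}\times\big[0,\tfrac{R_0}{2}\big]\big),$$ so $U(B)\subsetneq\Gamma(B)$. -/

import Mathlib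

open MeasureTheory Filter Topology
open scoped ENNReal

noncomputable section

/-- The statistics of a two-user fading channel: the law, on sequences indexed by time slots, of a
stationary ergodic process `h(t) = (h₁(t), h₂(t))` of nonnegative channel gains. -/
structure FadingChannel where
  law : Measure (ℕ → ℝ × ℝ)
  isProbabilityMeasure : IsProbabilityMeasure law
  ergodic : Ergodic (fun (x : ℕ → ℝ × ℝ) (t : ℕ) => x (t + 1)) law
  gain_nonneg : ∀ᵐ x ∂law, ∀ t, 0 ≤ (x t).1 ∧ 0 ≤ (x t).2

/-- The distribution of the pair of gains in one time slot. -/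
def FadingChannel.gainLaw (c : FadingChannel) : Measure (ℝ × ℝ) :=
  c.law.map (fun x => x 0)

/-- The Rayleigh distribution with scale parameter `σ`. -/
def rayleighMeasure (σ : ℝ) : Measure ℝ :=
  volume.withDensity fun x =>
    ENNReal.ofReal (if 0 < x then x / σ ^ 2 * Real.exp (-x ^ 2 / (2 * σ ^ 2)) else 0)

/-- The rate `log₂ (1 + h² s)` of a Gaussian link of gain `h` at power-to-noise ratio `s`. -/
def linkRate (h s : ℝ) : ℝ := Real.logb 2 (1 + h ^ 2 * s)

/-- A scheduling policy, for infinitely backlogged nodes, on a network in which `C h` is the set of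
rate vectors that can be transmitted reliably in a slot whose gains are `h`. In slot `t` the policy
picks a rate vector from the gains up to slot `t` and from a random seed, uniform on `[0, 1]` and
independent of the channel. -/
structure SchedulingPolicy (c : FadingChannel) (C : ℝ × ℝ → Set (ℝ × ℝ)) where
  rate : ℕ → (ℕ → ℝ × ℝ) × unitInterval → ℝ × ℝ
  measurable_rate : ∀ t, Measurable (rate t)
  causal : ∀ t x y u, (∀ s ≤ t, x s = y s) → rate t (x, u) = rate t (y, u)
  supported : ∀ t, ∀ᵐ ω ∂(c.law.prod (volume : Measure unitInterval)), rate t ω ∈ C (ω.1 t)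

/-- `ρ` is the long-run average departure rate vector of the policy. -/
def SchedulingPolicy.HasAverageRate {c : FadingChannel} {C : ℝ × ℝ → Set (ℝ × ℝ)}
    (π : SchedulingPolicy c C) (ρ : ℝ × ℝ) : Prop :=
  Tendsto (fun T : ℕ => (T : ℝ)⁻¹ • ∑ t ∈ Finset.range T,
    ∫ ω, π.rate t ω ∂(c.law.prod (volume : Measure unitInterval))) atTop (𝓝 ρ)

/-- The set of all average departure rate vectors that some scheduling policy achieves. -/
def averageRateRegion (c : FadingChannel) (C : ℝ × ℝ → Set (ℝ × ℝ)) : Set (ℝ × ℝ) :=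
  {ρ | ∃ π : SchedulingPolicy c C, π.HasAverageRate ρ}

/-- A two-user Gaussian broadcast network with unit noise power at both receivers, peak power
constraint `P(t) ≤ peakPower`, and the finite set `rates` of codebook rates (rate `0` meaning that
nothing is sent). -/
structure BCNetwork where
  channel : FadingChannel
  peakPower : ℝ
  peakPower_nonneg : 0 ≤ peakPower
  rates : Finset ℝ
  zero_mem_rates : 0 ∈ rates
  rates_nonneg : ∀ r ∈ rates, 0 ≤ r

/-- The rate vectors that the broadcast network supports at gains `h`: the power is split as
`p₁ + p₂ ≤ peakPower`; the weaker receiver treats the other codeword as noise, the stronger one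
decodes and cancels the codeword of the weaker one first. -/
def BCNetwork.supportedRates (B : BCNetwork) (h : ℝ × ℝ) : Set (ℝ × ℝ) :=
  {r | r.1 ∈ B.rates ∧ r.2 ∈ B.rates ∧
    ∃ p₁ p₂ : ℝ, 0 ≤ p₁ ∧ 0 ≤ p₂ ∧ p₁ + p₂ ≤ B.peakPower ∧
      ((h.2 < h.1 ∧ r.1 ≤ linkRate h.1 p₁ ∧ r.2 ≤ linkRate h.2 (p₂ / (1 + h.2 ^ 2 * p₁))) ∨
       (h.1 ≤ h.2 ∧ r.2 ≤ linkRate h.2 p₂ ∧ r.1 ≤ linkRate h.1 (p₁ / (1 + h.1 ^ 2 * p₂))))}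

/-- The stability region of the broadcast network. -/
def BCNetwork.stabilityRegion (B : BCNetwork) : Set (ℝ × ℝ) :=
  averageRateRegion B.channel B.supportedRates

/-- A two-user Gaussian multiple access network with unit noise power at the receiver, individual
peak power constraints `Pᵢ(t) ≤ peakPowerᵢ`, and finite sets of codebook rates. -/
structure MACNetwork where
  channel : FadingChannel
  peakPower₁ : ℝ
  peakPower₂ : ℝ
  peakPower₁_nonneg : 0 ≤ peakPower₁
  peakPower₂_nonneg : 0 ≤ peakPower₂
  rates₁ : Finset ℝ
  rates₂ : Finset ℝ
  zero_mem_rates₁ : 0 ∈ rates₁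
  zero_mem_rates₂ : 0 ∈ rates₂
  rates₁_nonneg : ∀ r ∈ rates₁, 0 ≤ r
  rates₂_nonneg : ∀ r ∈ rates₂, 0 ≤ r

/-- The rate vectors that the multiple access network supports at gains `h`: for some transmit
powers obeying the constraints, successive decoding succeeds with user 1 decoded first or with
user 2 decoded first. -/
def MACNetwork.supportedRates (M : MACNetwork) (h : ℝ × ℝ) : Set (ℝ × ℝ) :=
  {r | r.1 ∈ M.rates₁ ∧ r.2 ∈ M.rates₂ ∧
    ∃ p₁ p₂ : ℝ, 0 ≤ p₁ ∧ p₁ ≤ M.peakPower₁ ∧ 0 ≤ p₂ ∧ p₂ ≤ M.peakPower₂ ∧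
      ((r.1 ≤ linkRate h.1 (p₁ / (1 + h.2 ^ 2 * p₂)) ∧ r.2 ≤ linkRate h.2 p₂) ∨
       (r.2 ≤ linkRate h.2 (p₂ / (1 + h.1 ^ 2 * p₁)) ∧ r.1 ≤ linkRate h.1 p₁))}

/-- The stability region of the multiple access network. -/
def MACNetwork.stabilityRegion (M : MACNetwork) : Set (ℝ × ℝ) :=
  averageRateRegion M.channel M.supportedRates

/-- Duality of a multiple access and a broadcast network (both with peak power constraints and unit
noise power): the peak powers of the users add up to that of the broadcast transmitter, the channels
have the same statistics, and the codebook rates are the same. -/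
structure MACNetwork.IsDual (M : MACNetwork) (B : BCNetwork) : Prop where
  power : M.peakPower₁ + M.peakPower₂ = B.peakPower
  channel : M.channel.law = B.channel.law
  rates₁ : M.rates₁ = B.rates
  rates₂ : M.rates₂ = B.rates

/-- The union of the stability regions of all multiple access networks dual to `B`. -/
def BCNetwork.dualUnion (B : BCNetwork) : Set (ℝ × ℝ) :=
  ⋃ (M : MACNetwork) (_ : M.IsDual B), M.stabilityRegion

/-- The two-state on/off network: the gains are `(a, b)` or `(b, a)` with probability `1/2` each,
where `0 ≤ b < a`; there is one nonzero codebook rate `R₀`, and a link of gain `a` just supports it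
at full power. -/
structure BCNetwork.IsOnOff (B : BCNetwork) (a b P R₀ : ℝ) : Prop where
  gainLaw : B.channel.gainLaw =
    (2⁻¹ : ℝ≥0∞) • Measure.dirac (a, b) + (2⁻¹ : ℝ≥0∞) • Measure.dirac (b, a)
  peakPower : B.peakPower = P
  rates : B.rates = {0, R₀}
  off_nonneg : 0 ≤ b
  off_lt_on : b < a
  rate_eq : linkRate a P = R₀

end

/-! A broadcast transmitter may split its total power afresh in every slot, whereas each dual
multiple access network fixes the two users' budgets once and for all.

Containment holds slot by slot: `exists_broadcast_powers` converts successively decoded uplink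
powers into downlink powers with the same sum, so a policy for a dual network is also a policy for
`B`. Averages enter through `integral_mem_averageRateRegion` (achievability) and
`apply_le_integral_of_mem_averageRateRegion` (bounds); both reduce, by stationarity, to the gain law
of one slot.

Strictness comes from the finite rate set. If the total power is positive, some user of a dual
network has less than all of it. At an open set of gains this shortfall costs that user the smallest
positive rate, while the other user could not reach that rate even at full power. The mean of a
sum-rate maximizing choice for `B` is a single vector, chosen before the dual network, and every
dual network falls short of its sum rate by a positive amount. So this one vector lies outside the
whole union.

In the on/off network the threshold is met with no slack: a user with less than full power gets
nothing, so a dual network serves at most one user, while `B` serves whichever user is on. -/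

noncomputable section

/-! ### Monotonicity, continuity and thresholds of the link rate. -/

section LinkRate

lemma linkRate_zero (h : ℝ) : linkRate h 0 = 0 := by simp [linkRate]

lemma linkRate_le_linkRate {h k s t : ℝ} (hs : 0 ≤ s) (hst : h ^ 2 * s ≤ k ^ 2 * t) :
    linkRate h s ≤ linkRate k t := by
  have : 0 ≤ h ^ 2 * s := by positivity
  exact Real.logb_le_logb_of_le one_lt_two (by linarith) (by linarith)

lemma linkRate_lt_linkRate {h k s t : ℝ} (hs : 0 ≤ s) (hst : h ^ 2 * s < k ^ 2 * t) :
    linkRate h s < linkRate k t := by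
  have : 0 ≤ h ^ 2 * s := by positivity
  exact Real.logb_lt_logb one_lt_two (by linarith) (by linarith)

lemma linkRate_mono {h s t : ℝ} (hs : 0 ≤ s) (hst : s ≤ t) : linkRate h s ≤ linkRate h t :=
  linkRate_le_linkRate hs (by gcongr)

lemma linkRate_nonneg {h s : ℝ} (hs : 0 ≤ s) : 0 ≤ linkRate h s :=
  linkRate_zero h ▸ linkRate_mono le_rfl hs

lemma div_one_add_le {p x : ℝ} (hp : 0 ≤ p) (hx : 0 ≤ x) : p / (1 + x) ≤ p :=
  div_le_self hp (by linarith)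

lemma Continuous.linkRate {X : Type*} [TopologicalSpace X] {f g : X → ℝ} (hf : Continuous f)
    (hg : Continuous g) (h0 : ∀ x, 0 ≤ g x) : Continuous fun x => linkRate (f x) (g x) := by
  unfold _root_.linkRate Real.logb
  refine Continuous.div_const (Continuous.log (by fun_prop) fun x => ?_) _
  have := mul_nonneg (sq_nonneg (f x)) (h0 x)
  linarith

/-- There is a gain at which the power `P` supports the rate `R` but the smaller power `Q` does not,
and a gain at which `P` does not support `R`. -/
lemma exists_gains_separating {R P Q : ℝ} (hR : 0 < R) (hQ : 0 ≤ Q) (hQP : Q < P) :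
    ∃ x y : ℝ, 0 < x ∧ 0 < y ∧ R < linkRate x P ∧ linkRate x Q < R ∧ linkRate y P < R := by
  have hP : 0 < P := hQ.trans_lt hQP
  set D : ℝ := 2 ^ R - 1 with hD
  have hD0 : 0 < D := by
    have := Real.one_lt_rpow one_lt_two hR
    linarith
  have hRD : R = linkRate 1 D := by
    simp [linkRate, hD, Real.logb_rpow]
  -- `D` is the received power needed for rate `R`. Dividing it by the midpoint of `P` and `Q` puts
  -- the threshold strictly between them, even when `Q = 0`; the second gain delivers only `D / 2`
  -- at power `P`.
  refine ⟨√(2 * D / (P + Q)), √(D / (2 * P)), by positivity, by positivity, ?_, ?_, ?_⟩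
  · rw [hRD]
    refine linkRate_lt_linkRate hD0.le ?_
    rw [Real.sq_sqrt (by positivity), div_mul_eq_mul_div, lt_div_iff₀ (by positivity)]
    nlinarith
  · rw [hRD]
    refine linkRate_lt_linkRate hQ ?_
    rw [Real.sq_sqrt (by positivity), div_mul_eq_mul_div, div_lt_iff₀ (by positivity)]
    nlinarith
  · rw [hRD]
    refine linkRate_lt_linkRate hP.le ?_
    rw [Real.sq_sqrt (by positivity)]
    field_simp
    norm_num

end LinkRate

/-! ### Rates supported in one slot: duality, single-user bounds, measurability. -/

section SupportedRates

/-- The uplink-downlink power conversion: rates that are decoded successively at total power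
`p + q`, in either order, can be broadcast at the same total power. -/
lemma exists_broadcast_powers {h k p q r s : ℝ} (hp : 0 ≤ p) (hq : 0 ≤ q) (hkh : k ^ 2 ≤ h ^ 2)
    (hrs : (r ≤ linkRate h (p / (1 + k ^ 2 * q)) ∧ s ≤ linkRate k q) ∨
      (s ≤ linkRate k (q / (1 + h ^ 2 * p)) ∧ r ≤ linkRate h p)) :
    ∃ p' q' : ℝ, 0 ≤ p' ∧ 0 ≤ q' ∧ p' + q' = p + q ∧ r ≤ linkRate h p' ∧
      s ≤ linkRate k (q' / (1 + k ^ 2 * p')) := by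
  rcases hrs with ⟨hr, hs⟩ | ⟨hs, hr⟩
  · have hk : 0 < 1 + k ^ 2 * q := by positivity
    have hp' : 0 ≤ p / (1 + k ^ 2 * q) := by positivity
    -- The stronger user receives the power it effectively had under interference; the weaker user's
    -- power is scaled up so that its signal-to-interference ratio is again `q`. The saving and the
    -- surcharge cancel exactly.
    refine ⟨p / (1 + k ^ 2 * q), q * (1 + k ^ 2 * (p / (1 + k ^ 2 * q))), hp', by positivity,
      by field_simp; ring, hr, ?_⟩
    rwa [mul_div_cancel_right₀ _ (by positivity)]
  -- No conversion is needed: downlink interference reaches the weaker receiver through its own gain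
  -- `k`, so it is at most the uplink interference seen through `h`.
  · refine ⟨p, q, hp, hq, rfl, hr, hs.trans (linkRate_mono (by positivity) ?_)⟩
    gcongr

lemma MACNetwork.IsDual.supportedRates_subset {B : BCNetwork} {M : MACNetwork} (hM : M.IsDual B)
    {h : ℝ × ℝ} (h₁ : 0 ≤ h.1) (h₂ : 0 ≤ h.2) : M.supportedRates h ⊆ B.supportedRates h := by
  rintro r ⟨hr₁, hr₂, p₁, p₂, hp₁, hP₁, hp₂, hP₂, hr⟩
  refine ⟨hM.rates₁ ▸ hr₁, hM.rates₂ ▸ hr₂, ?_⟩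
  have hP : p₁ + p₂ ≤ B.peakPower := hM.power ▸ add_le_add hP₁ hP₂
  rcases lt_or_ge h.2 h.1 with hlt | hle
  · obtain ⟨q₁, q₂, hq₁, hq₂, hq, H₁, H₂⟩ :=
      exists_broadcast_powers hp₁ hp₂ (by gcongr) hr
    exact ⟨q₁, q₂, hq₁, hq₂, hq.trans_le hP, .inl ⟨hlt, H₁, H₂⟩⟩
  · obtain ⟨q₂, q₁, hq₂, hq₁, hq, H₂, H₁⟩ :=
      exists_broadcast_powers hp₂ hp₁ (by gcongr) hr.symm
    exact ⟨q₁, q₂, hq₁, hq₂, by linarith, .inr ⟨hle, H₂, H₁⟩⟩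

/-- Interference can only lower a rate. This crude bound, blind to the decoding order, is all that
the impossibility arguments for dual networks need. -/
lemma MACNetwork.supportedRates_le {M : MACNetwork} {h r : ℝ × ℝ} (hr : r ∈ M.supportedRates h) :
    r.1 ≤ linkRate h.1 M.peakPower₁ ∧ r.2 ≤ linkRate h.2 M.peakPower₂ := by
  obtain ⟨-, -, p₁, p₂, hp₁, hP₁, hp₂, hP₂, ⟨H₁, H₂⟩ | ⟨H₂, H₁⟩⟩ := hr
  · exact ⟨H₁.trans (linkRate_mono (by positivity)
      ((div_one_add_le hp₁ (by positivity)).trans hP₁)), H₂.trans (linkRate_mono hp₂ hP₂)⟩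
  · exact ⟨H₁.trans (linkRate_mono hp₁ hP₁), H₂.trans (linkRate_mono (by positivity)
      ((div_one_add_le hp₂ (by positivity)).trans hP₂))⟩

lemma BCNetwork.supportedRates_le {B : BCNetwork} {h r : ℝ × ℝ} (hr : r ∈ B.supportedRates h) :
    r.1 ≤ linkRate h.1 B.peakPower ∧ r.2 ≤ linkRate h.2 B.peakPower := by
  obtain ⟨-, -, p₁, p₂, hp₁, hp₂, hP, ⟨-, H₁, H₂⟩ | ⟨-, H₂, H₁⟩⟩ := hr
  · exact ⟨H₁.trans (linkRate_mono hp₁ (by linarith)), H₂.trans (linkRate_mono (by positivity)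
      ((div_one_add_le hp₂ (by positivity)).trans (by linarith)))⟩
  · exact ⟨H₁.trans (linkRate_mono (by positivity)
      ((div_one_add_le hp₁ (by positivity)).trans (by linarith))),
      H₂.trans (linkRate_mono hp₂ (by linarith))⟩

lemma BCNetwork.mk_zero_mem_supportedRates {B : BCNetwork} {h : ℝ × ℝ} {R : ℝ} (hR : R ∈ B.rates)
    (hle : R ≤ linkRate h.1 B.peakPower) : (R, 0) ∈ B.supportedRates h := by
  refine ⟨hR, B.zero_mem_rates, B.peakPower, 0, B.peakPower_nonneg, le_rfl, by simp, ?_⟩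
  rcases lt_or_ge h.2 h.1 with hlt | hge
  · exact .inl ⟨hlt, hle, by simp [linkRate_zero]⟩
  · exact .inr ⟨hge, by simp [linkRate_zero], by simpa using hle⟩

lemma BCNetwork.zero_mk_mem_supportedRates {B : BCNetwork} {h : ℝ × ℝ} {R : ℝ} (hR : R ∈ B.rates)
    (hle : R ≤ linkRate h.2 B.peakPower) : (0, R) ∈ B.supportedRates h := by
  refine ⟨B.zero_mem_rates, hR, 0, B.peakPower, le_rfl, B.peakPower_nonneg, by simp, ?_⟩
  rcases lt_or_ge h.2 h.1 with hlt | hge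
  · exact .inl ⟨hlt, by simp [linkRate_zero], by simpa using hle⟩
  · exact .inr ⟨hge, hle, by simp [linkRate_zero]⟩

lemma BCNetwork.zero_mem_supportedRates (B : BCNetwork) (h : ℝ × ℝ) : 0 ∈ B.supportedRates h :=
  B.mk_zero_mem_supportedRates B.zero_mem_rates (linkRate_nonneg B.peakPower_nonneg)

lemma MACNetwork.mk_zero_mem_supportedRates {M : MACNetwork} {h : ℝ × ℝ} {R : ℝ}
    (hR : R ∈ M.rates₁) (hle : R ≤ linkRate h.1 M.peakPower₁) : (R, 0) ∈ M.supportedRates h :=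
  ⟨hR, M.zero_mem_rates₂, M.peakPower₁, 0, M.peakPower₁_nonneg, le_rfl, le_rfl,
    M.peakPower₂_nonneg, .inl ⟨by simpa using hle, by simp [linkRate_zero]⟩⟩

lemma MACNetwork.zero_mk_mem_supportedRates {M : MACNetwork} {h : ℝ × ℝ} {R : ℝ}
    (hR : R ∈ M.rates₂) (hle : R ≤ linkRate h.2 M.peakPower₂) : (0, R) ∈ M.supportedRates h :=
  ⟨M.zero_mem_rates₁, hR, 0, M.peakPower₂, le_rfl, M.peakPower₁_nonneg, M.peakPower₂_nonneg,
    le_rfl, .inl ⟨by simp [linkRate_zero], hle⟩⟩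

lemma MACNetwork.zero_mem_supportedRates (M : MACNetwork) (h : ℝ × ℝ) : 0 ∈ M.supportedRates h :=
  M.mk_zero_mem_supportedRates M.zero_mem_rates₁ (linkRate_nonneg M.peakPower₁_nonneg)

/-- The power splits form a compact set, so for each decoding order eliminating them projects a
closed set to a closed set. The regions in which each order applies are Borel. This allows a
measurable choice of rates. -/
lemma BCNetwork.measurableSet_mem_supportedRates (B : BCNetwork) (r : ℝ × ℝ) :
    MeasurableSet {h | r ∈ B.supportedRates h} := by
  let K : Set (ℝ × ℝ) := {p | 0 ≤ p.1 ∧ 0 ≤ p.2 ∧ p.1 + p.2 ≤ B.peakPower}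
  have hK : IsCompact K := by
    refine (isCompact_Icc (a := ((0 : ℝ), (0 : ℝ)))
      (b := (B.peakPower, B.peakPower))).of_isClosed_subset ?_ ?_
    · simp only [K, Set.ofPred_and]
      exact (isClosed_le (by fun_prop) (by fun_prop)).inter
        ((isClosed_le (by fun_prop) (by fun_prop)).inter (isClosed_le (by fun_prop) (by fun_prop)))
    · rintro p ⟨h₁, h₂, h₃⟩
      exact ⟨⟨h₁, h₂⟩, ⟨by simp only; linarith, by simp only; linarith⟩⟩
  have : CompactSpace K := isCompact_iff_compactSpace.mp hK
  let A₁ : Set ((ℝ × ℝ) × K) := {z | r.1 ≤ linkRate z.1.1 z.2.1.1 ∧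
    r.2 ≤ linkRate z.1.2 (z.2.1.2 / (1 + z.1.2 ^ 2 * z.2.1.1))}
  let A₂ : Set ((ℝ × ℝ) × K) := {z | r.2 ≤ linkRate z.1.2 z.2.1.2 ∧
    r.1 ≤ linkRate z.1.1 (z.2.1.1 / (1 + z.1.1 ^ 2 * z.2.1.2))}
  have pos₁ (x : ℝ) (p : K) : 0 < 1 + x ^ 2 * p.1.1 := by
    have := p.2.1
    positivity
  have pos₂ (x : ℝ) (p : K) : 0 < 1 + x ^ 2 * p.1.2 := by
    have := p.2.2.1
    positivity
  have hA₁ : IsClosed A₁ := by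
    simp only [A₁, Set.ofPred_and]
    refine (isClosed_le continuous_const (Continuous.linkRate (by fun_prop) (by fun_prop)
      fun z => z.2.2.1)).inter (isClosed_le continuous_const (Continuous.linkRate (by fun_prop)
      (Continuous.div (by fun_prop) (by fun_prop) fun z => (pos₁ _ _).ne')
      fun z => div_nonneg z.2.2.2.1 (pos₁ _ _).le))
  have hA₂ : IsClosed A₂ := by
    simp only [A₂, Set.ofPred_and]
    refine (isClosed_le continuous_const (Continuous.linkRate (by fun_prop) (by fun_prop)
      fun z => z.2.2.2.1)).inter (isClosed_le continuous_const (Continuous.linkRate (by fun_prop)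
      (Continuous.div (by fun_prop) (by fun_prop) fun z => (pos₂ _ _).ne')
      fun z => div_nonneg z.2.2.1 (pos₂ _ _).le))
  have heq : {h | r ∈ B.supportedRates h} = {_h | r.1 ∈ B.rates ∧ r.2 ∈ B.rates} ∩
      (({h | h.2 < h.1} ∩ Prod.fst '' A₁) ∪ ({h | h.1 ≤ h.2} ∩ Prod.fst '' A₂)) := by
    ext h
    constructor
    · rintro ⟨hr₁, hr₂, p₁, p₂, hp₁, hp₂, hP, ⟨hlt, H⟩ | ⟨hle, H⟩⟩
      · exact ⟨⟨hr₁, hr₂⟩, .inl ⟨hlt, ⟨(h, ⟨(p₁, p₂), hp₁, hp₂, hP⟩), H, rfl⟩⟩⟩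
      · exact ⟨⟨hr₁, hr₂⟩, .inr ⟨hle, ⟨(h, ⟨(p₁, p₂), hp₁, hp₂, hP⟩), H, rfl⟩⟩⟩
    · rintro ⟨⟨hr₁, hr₂⟩, ⟨hlt, ⟨z, H, rfl⟩⟩ | ⟨hle, ⟨z, H, rfl⟩⟩⟩
      · exact ⟨hr₁, hr₂, z.2.1.1, z.2.1.2, z.2.2.1, z.2.2.2.1, z.2.2.2.2, .inl ⟨hlt, H⟩⟩
      · exact ⟨hr₁, hr₂, z.2.1.1, z.2.1.2, z.2.2.1, z.2.2.2.1, z.2.2.2.2, .inr ⟨hle, H⟩⟩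
  rw [heq]
  refine (MeasurableSet.const _).inter (MeasurableSet.union ?_ ?_)
  · exact (measurableSet_lt measurable_snd measurable_fst).inter
      (isClosedMap_fst_of_compactSpace _ hA₁).measurableSet
  · exact (measurableSet_le measurable_fst measurable_snd).inter
      (isClosedMap_fst_of_compactSpace _ hA₂).measurableSet

/-- If a multiple access network dual to `B` grants a user less than the full power, then at
an open set of gains `B` supports a positive rate while the multiple access network supports
nothing. -/
lemma MACNetwork.IsDual.exists_isOpen_supportedRates_eq_zero {B : BCNetwork} {M : MACNetwork}
    (hM : M.IsDual B) (hP : 0 < B.peakPower) (hB : ∃ R ∈ B.rates, 0 < R) :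
    ∃ U : Set (ℝ × ℝ), IsOpen U ∧ U.Nonempty ∧ (∀ h ∈ U, 0 < h.1 ∧ 0 < h.2) ∧
      ∃ R : ℝ, 0 < R ∧ ∀ h ∈ U, (∃ r ∈ B.supportedRates h, r.1 + r.2 = R) ∧
        ∀ r ∈ M.supportedRates h, r = 0 := by
  -- With `R` the least positive codebook rate, any rate bounded strictly below `R` must vanish.
  obtain ⟨R, hR, hmin⟩ := (B.rates.filter (0 < ·)).exists_min_image id
    (by obtain ⟨R, hR, hR0⟩ := hB; exact ⟨R, by simp [hR, hR0]⟩)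
  obtain ⟨hRB, hR0⟩ := Finset.mem_filter.mp hR
  have eq_zero {x : ℝ} (hx : x ∈ B.rates) (hxR : x < R) : x = 0 := by
    by_contra hne
    have := hmin x (Finset.mem_filter.mpr ⟨hx, (B.rates_nonneg x hx).lt_of_ne' hne⟩)
    exact absurd this (not_le.mpr hxR)
  have h₁ := M.peakPower₁_nonneg
  have h₂ := M.peakPower₂_nonneg
  have hsum := hM.power
  -- If user 1 has the full power, then user 2 has none. The short-changed user gets a gain at which
  -- its missing power matters, the other a gain too weak for `R` at any budget.
  rcases lt_or_ge M.peakPower₁ B.peakPower with hlt | hge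
  · obtain ⟨x, y, hx, hy, hxP, hxQ, hyP⟩ := exists_gains_separating hR0 h₁ hlt
    refine ⟨{h | 0 < h.1 ∧ 0 < h.2 ∧ R < linkRate h.1 B.peakPower ∧
      linkRate h.1 M.peakPower₁ < R ∧ linkRate h.2 B.peakPower < R}, ?_,
      ⟨(x, y), hx, hy, hxP, hxQ, hyP⟩, fun h hh => ⟨hh.1, hh.2.1⟩, R, hR0, ?_⟩
    · simp only [Set.ofPred_and]
      refine (isOpen_lt ?_ ?_).inter ((isOpen_lt ?_ ?_).inter ((isOpen_lt ?_ ?_).inter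
        ((isOpen_lt ?_ ?_).inter (isOpen_lt ?_ ?_)))) <;>
      first
      | fun_prop
      | exact Continuous.linkRate (by fun_prop) (by fun_prop) fun _ => by linarith
    · rintro h ⟨-, -, H₁, H₂, H₃⟩
      refine ⟨⟨_, B.mk_zero_mem_supportedRates hRB H₁.le, by simp⟩, fun r hr => Prod.ext ?_ ?_⟩
      · exact eq_zero (hM.rates₁ ▸ hr.1) ((M.supportedRates_le hr).1.trans_lt H₂)
      · exact eq_zero (hM.rates₂ ▸ hr.2.1) (((M.supportedRates_le hr).2.trans
          (linkRate_mono h₂ (by linarith))).trans_lt H₃)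
  · obtain ⟨x, y, hx, hy, hxP, hxQ, hyP⟩ :=
      exists_gains_separating hR0 h₂ (show M.peakPower₂ < B.peakPower by linarith)
    refine ⟨{h | 0 < h.1 ∧ 0 < h.2 ∧ R < linkRate h.2 B.peakPower ∧
      linkRate h.2 M.peakPower₂ < R ∧ linkRate h.1 B.peakPower < R}, ?_,
      ⟨(y, x), hy, hx, hxP, hxQ, hyP⟩, fun h hh => ⟨hh.1, hh.2.1⟩, R, hR0, ?_⟩
    · simp only [Set.ofPred_and]
      refine (isOpen_lt ?_ ?_).inter ((isOpen_lt ?_ ?_).inter ((isOpen_lt ?_ ?_).inter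
        ((isOpen_lt ?_ ?_).inter (isOpen_lt ?_ ?_)))) <;>
      first
      | fun_prop
      | exact Continuous.linkRate (by fun_prop) (by fun_prop) fun _ => by linarith
    · rintro h ⟨-, -, H₁, H₂, H₃⟩
      refine ⟨⟨_, B.zero_mk_mem_supportedRates hRB H₁.le, by simp⟩, fun r hr => Prod.ext ?_ ?_⟩
      · exact eq_zero (hM.rates₁ ▸ hr.1) (((M.supportedRates_le hr).1.trans
          (linkRate_mono h₁ (by linarith))).trans_lt H₃)
      · exact eq_zero (hM.rates₂ ▸ hr.2.1) ((M.supportedRates_le hr).2.trans_lt H₂)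

end SupportedRates

/-! ### From single slots to long-run averages. -/

section Averages

instance (c : FadingChannel) : IsProbabilityMeasure c.law := c.isProbabilityMeasure

lemma FadingChannel.ext_law {c d : FadingChannel} (h : c.law = d.law) : c = d := by
  cases c
  cases d
  simp_all

instance (c : FadingChannel) : IsProbabilityMeasure c.gainLaw :=
  Measure.isProbabilityMeasure_map (measurable_pi_apply 0).aemeasurable

lemma FadingChannel.measurePreserving_eval (c : FadingChannel) (t : ℕ) :
    MeasurePreserving (fun x => x t) c.law c.gainLaw := by
  induction t with
  | zero => exact ⟨measurable_pi_apply 0, rfl⟩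
  | succ t ih => exact ih.comp c.ergodic.toMeasurePreserving

lemma FadingChannel.measurePreserving_eval_fst (c : FadingChannel) (t : ℕ) :
    MeasurePreserving (fun ω : (ℕ → ℝ × ℝ) × unitInterval => ω.1 t)
      (c.law.prod volume) c.gainLaw :=
  (c.measurePreserving_eval t).comp measurePreserving_fst

lemma FadingChannel.ae_gainLaw_nonneg (c : FadingChannel) :
    ∀ᵐ h ∂c.gainLaw, 0 ≤ h.1 ∧ 0 ≤ h.2 := by
  rw [← (c.measurePreserving_eval 0).map_eq,
    ae_map_iff (c.measurePreserving_eval 0).measurable.aemeasurable]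
  · filter_upwards [c.gain_nonneg] with x hx using hx 0
  · exact (measurableSet_le measurable_const measurable_fst).inter
      (measurableSet_le measurable_const measurable_snd)

/-- A randomized choice of a supported rate vector that depends on the current gains only achieves
its mean rate vector. -/
lemma integral_mem_averageRateRegion (c : FadingChannel) {C : ℝ × ℝ → Set (ℝ × ℝ)}
    {f : (ℝ × ℝ) × unitInterval → ℝ × ℝ} (hf : Measurable f) (hfC : ∀ z, f z ∈ C z.1) :
    ∫ z, f z ∂(c.gainLaw.prod volume) ∈ averageRateRegion c C := by
  -- The same seed is reused in all slots: only expectations are averaged, so dependence across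
  -- slots is harmless.
  refine ⟨⟨fun t ω => f (ω.1 t, ω.2), fun t => by fun_prop, fun t x y u h => ?_,
    fun t => ae_of_all _ fun ω => hfC (ω.1 t, ω.2)⟩, ?_⟩
  · simp only [h t le_rfl]
  · have key (t : ℕ) : ∫ ω, f (ω.1 t, ω.2) ∂(c.law.prod (volume : Measure unitInterval)) =
        ∫ z, f z ∂(c.gainLaw.prod volume) := by
      have h := (c.measurePreserving_eval t).prod (.id (volume : Measure unitInterval))
      rw [← h.map_eq, integral_map h.measurable.aemeasurable hf.aestronglyMeasurable]
      rfl
    refine tendsto_const_nhds.congr' ?_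
    filter_upwards [eventually_gt_atTop 0] with T hT
    simp only [key, Finset.sum_const, Finset.card_range]
    rw [← Nat.cast_smul_eq_nsmul ℝ, smul_smul, inv_mul_cancel₀ (by positivity), one_smul]

/-- A linear functional of the average rates is at most the mean of any function of the gains that
dominates it on the supported rate vectors. -/
lemma apply_le_integral_of_mem_averageRateRegion {c : FadingChannel} {C : ℝ × ℝ → Set (ℝ × ℝ)}
    {S : Set (ℝ × ℝ)} (hS : Bornology.IsBounded S) (hCS : ∀ h, C h ⊆ S) (φ : ℝ × ℝ →L[ℝ] ℝ)
    {g : ℝ × ℝ → ℝ} (hg : Integrable g c.gainLaw)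
    (hle : ∀ᵐ h ∂c.gainLaw, ∀ r ∈ C h, φ r ≤ g h) {ρ : ℝ × ℝ} (hρ : ρ ∈ averageRateRegion c C) :
    φ ρ ≤ ∫ h, g h ∂c.gainLaw := by
  obtain ⟨π, hπ⟩ := hρ
  obtain ⟨K, hK⟩ := hS.exists_norm_le
  -- The domination holds pointwise in the current gains, whose law does not depend on `t`; history
  -- and randomization therefore cannot beat the one-slot mean.
  have key (t : ℕ) : φ (∫ ω, π.rate t ω ∂(c.law.prod volume)) ≤ ∫ h, g h ∂c.gainLaw := by
    have hint : Integrable (π.rate t) (c.law.prod volume) :=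
      .of_bound (π.measurable_rate t).aestronglyMeasurable K
        ((π.supported t).mono fun ω hω => hK _ (hCS _ hω))
    have hmp := c.measurePreserving_eval_fst t
    rw [← φ.integral_comp_comm hint, ← hmp.map_eq, integral_map hmp.measurable.aemeasurable
      (hmp.map_eq.symm ▸ hg.aestronglyMeasurable)]
    refine integral_mono_ae (φ.integrable_comp hint) (hmp.integrable_comp_of_integrable hg) ?_
    filter_upwards [π.supported t, hmp.quasiMeasurePreserving.ae hle] with ω hω hle using hle _ hω
  refine le_of_tendsto ((φ.continuous.tendsto ρ).comp hπ) ?_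
  filter_upwards [eventually_gt_atTop 0] with T hT
  simp only [Function.comp_apply, map_smul, map_sum, smul_eq_mul]
  have hT' : (0 : ℝ) < T := by positivity
  rw [inv_mul_le_iff₀ hT']
  refine (Finset.sum_le_sum fun t _ => key t).trans ?_
  simp

/-- The policy is kept unchanged. An almost sure inclusion is the right hypothesis because the gains
are nonnegative only almost surely. -/
lemma averageRateRegion_mono {c : FadingChannel} {C D : ℝ × ℝ → Set (ℝ × ℝ)}
    (h : ∀ᵐ x ∂c.gainLaw, C x ⊆ D x) : averageRateRegion c C ⊆ averageRateRegion c D := by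
  rintro ρ ⟨π, hπ⟩
  refine ⟨⟨π.rate, π.measurable_rate, π.causal, fun t => ?_⟩, hπ⟩
  filter_upwards [π.supported t, (c.measurePreserving_eval_fst t).quasiMeasurePreserving.ae h]
    with ω hω hsub using hsub hω

lemma MACNetwork.IsDual.stabilityRegion_eq {B : BCNetwork} {M : MACNetwork} (hM : M.IsDual B) :
    M.stabilityRegion = averageRateRegion B.channel M.supportedRates := by
  rw [MACNetwork.stabilityRegion, FadingChannel.ext_law hM.channel]

lemma MACNetwork.IsDual.stabilityRegion_subset {B : BCNetwork} {M : MACNetwork}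
    (hM : M.IsDual B) : M.stabilityRegion ⊆ B.stabilityRegion := by
  rw [hM.stabilityRegion_eq]
  refine averageRateRegion_mono ?_
  filter_upwards [B.channel.ae_gainLaw_nonneg] with h hh
    using hM.supportedRates_subset hh.1 hh.2

lemma BCNetwork.dualUnion_subset (B : BCNetwork) : B.dualUnion ⊆ B.stabilityRegion :=
  Set.iUnion₂_subset fun _ hM => hM.stabilityRegion_subset

lemma BCNetwork.supportedRates_subset (B : BCNetwork) (h : ℝ × ℝ) :
    B.supportedRates h ⊆ ↑(B.rates ×ˢ B.rates) := fun _ hr =>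
  Finset.mem_coe.mpr (Finset.mem_product.mpr ⟨hr.1, hr.2.1⟩)

lemma MACNetwork.supportedRates_subset (M : MACNetwork) (h : ℝ × ℝ) :
    M.supportedRates h ⊆ ↑(M.rates₁ ×ˢ M.rates₂) := fun _ hr =>
  Finset.mem_coe.mpr (Finset.mem_product.mpr ⟨hr.1, hr.2.1⟩)

end Averages

/-! ### Strict containment for gain laws with full support. -/

section StrictContainment

/-- A measurable choice of the best admissible element of a finite set. -/
lemma exists_measurable_selection_forall_le {X Y : Type*} [MeasurableSpace X] [MeasurableSpace Y]
    {C : X → Set Y} (hC : ∀ y, MeasurableSet {x | y ∈ C x}) {y₀ : Y} (hy₀ : ∀ x, y₀ ∈ C x)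
    {φ : Y → ℝ} (hφ : Measurable φ) (F : Finset Y) :
    ∃ s : X → Y, Measurable s ∧ (∀ x, s x ∈ C x) ∧ ∀ x, ∀ y ∈ F, y ∈ C x → φ y ≤ φ (s x) := by
  classical
  induction F using Finset.induction_on with
  | empty => exact ⟨fun _ => y₀, measurable_const, hy₀, by simp⟩
  | insert y F _ ih =>
    obtain ⟨s, hs, hsC, hsF⟩ := ih
    refine ⟨fun x => if y ∈ C x ∧ φ (s x) < φ y then y else s x,
      Measurable.ite ((hC y).inter (measurableSet_lt (hφ.comp hs) measurable_const))
        measurable_const hs, fun x => ?_, fun x z hz hzC => ?_⟩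
    · dsimp only
      split_ifs with h
      exacts [h.1, hsC x]
    · dsimp only
      rcases Finset.mem_insert.mp hz with rfl | hz
      · split_ifs with h
        · exact le_rfl
        · exact not_lt.mp fun hlt => h ⟨hzC, hlt⟩
      · split_ifs with h
        · exact (hsF x z hz hzC).trans h.2.le
        · exact hsF x z hz hzC

/-- The separating vector is the mean of a sum-rate maximizing selection. A dual network containing
it would have to match the maximal sum rate, yet it loses at least `R` on a set of gains of positive
probability. -/
lemma BCNetwork.dualUnion_ssubset_of_gainLaw_pos {B : BCNetwork}
    (hpos : ∀ U : Set (ℝ × ℝ), IsOpen U → U.Nonempty → (∀ h ∈ U, 0 < h.1 ∧ 0 < h.2) →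
      0 < B.channel.gainLaw U)
    (hP : 0 < B.peakPower) (hB : ∃ R ∈ B.rates, 0 < R) : B.dualUnion ⊂ B.stabilityRegion := by
  let φ : ℝ × ℝ →L[ℝ] ℝ := .fst ℝ ℝ ℝ + .snd ℝ ℝ ℝ
  obtain ⟨s, hs, hsC, hmax⟩ := exists_measurable_selection_forall_le
    B.measurableSet_mem_supportedRates B.zero_mem_supportedRates φ.continuous.measurable
    (B.rates ×ˢ B.rates)
  replace hmax {h r : ℝ × ℝ} (hr : r ∈ B.supportedRates h) : φ r ≤ φ (s h) :=
    hmax h r (B.supportedRates_subset h hr) hr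
  obtain ⟨K, hK⟩ := (B.rates ×ˢ B.rates).finite_toSet.isBounded.exists_norm_le
  have hint : Integrable s B.channel.gainLaw := .of_bound hs.aestronglyMeasurable K
    (ae_of_all _ fun h => hK _ (B.supportedRates_subset h (hsC h)))
  have hmem : ∫ h, s h ∂B.channel.gainLaw ∈ B.stabilityRegion := by
    have := integral_mem_averageRateRegion B.channel (f := fun z => s z.1) (by fun_prop)
      fun z => hsC z.1
    rwa [integral_fun_fst, probReal_univ, one_smul] at this
  refine ⟨B.dualUnion_subset, fun hsub => ?_⟩
  obtain ⟨M, hM, hmemM⟩ := Set.mem_iUnion₂.mp (hsub hmem)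
  rw [hM.stabilityRegion_eq] at hmemM
  obtain ⟨U, hUo, hUne, hUpos, R, hR, hU⟩ := hM.exists_isOpen_supportedRates_eq_zero hP hB
  have hle : ∀ᵐ h ∂B.channel.gainLaw, ∀ r ∈ M.supportedRates h,
      φ r ≤ φ (s h) - U.indicator (fun _ => R) h := by
    filter_upwards [B.channel.ae_gainLaw_nonneg] with h hh r hr
    by_cases hhU : h ∈ U
    · obtain ⟨⟨q, hq, rfl⟩, hzero⟩ := hU h hhU
      rw [hzero r hr, Set.indicator_of_mem hhU, map_zero, sub_nonneg]
      exact hmax hq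
    · simpa [hhU] using hmax (hM.supportedRates_subset hh.1 hh.2 hr)
  have hintφ := φ.integrable_comp hint
  have hintU : Integrable (U.indicator fun _ => R) B.channel.gainLaw :=
    (integrable_const R).indicator hUo.measurableSet
  have := apply_le_integral_of_mem_averageRateRegion (M.rates₁ ×ˢ M.rates₂).finite_toSet.isBounded
    M.supportedRates_subset φ (hintφ.sub hintU) hle hmemM
  simp only [Pi.sub_apply] at this
  rw [integral_sub hintφ hintU, φ.integral_comp_comm hint,
    integral_indicator_const _ hUo.measurableSet, smul_eq_mul] at this
  have hpos' : 0 < B.channel.gainLaw.real U :=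
    ENNReal.toReal_pos (hpos U hUo hUne hUpos).ne' (measure_ne_top _ _)
  nlinarith [mul_pos hpos' hR]

lemma rayleighMeasure_pos {σ : ℝ} (hσ : 0 < σ) {U : Set ℝ} (hU : IsOpen U) {x : ℝ} (hx : x ∈ U)
    (hx0 : 0 < x) : 0 < rayleighMeasure σ U := by
  have hm : Measurable fun x : ℝ => ENNReal.ofReal
      (if 0 < x then x / σ ^ 2 * Real.exp (-x ^ 2 / (2 * σ ^ 2)) else 0) :=
    (Measurable.ite measurableSet_Ioi (by fun_prop) measurable_const).ennreal_ofReal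
  refine pos_iff_ne_zero.mpr fun h => ?_
  rw [rayleighMeasure, withDensity_apply_eq_zero hm] at h
  have hpos := (hU.inter isOpen_Ioi).measure_pos volume ⟨x, hx, hx0⟩
  refine hpos.ne' (measure_mono_null ?_ h)
  rintro y ⟨hyU, hy : 0 < y⟩
  refine ⟨?_, hyU⟩
  simp only [Set.mem_ofPred_eq, if_pos hy, ne_eq, ENNReal.ofReal_eq_zero, not_le]
  positivity

lemma rayleighMeasure_prod_pos {σ₁ σ₂ : ℝ} (h₁ : 0 < σ₁) (h₂ : 0 < σ₂) {U : Set (ℝ × ℝ)}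
    (hU : IsOpen U) (hne : U.Nonempty) (hpos : ∀ h ∈ U, 0 < h.1 ∧ 0 < h.2) :
    0 < (rayleighMeasure σ₁).prod (rayleighMeasure σ₂) U := by
  obtain ⟨⟨x, y⟩, hxy⟩ := hne
  obtain ⟨V, W, hV, hW, hx, hy, hVW⟩ := isOpen_prod_iff.mp hU x y hxy
  -- Needed for the product measure of a rectangle to factor.
  have : SFinite (rayleighMeasure σ₂) := by unfold rayleighMeasure; infer_instance
  refine lt_of_lt_of_le ?_ (measure_mono hVW)
  rw [Measure.prod_prod]
  exact ENNReal.mul_pos (rayleighMeasure_pos h₁ hV hx (hpos _ hxy).1).ne'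
    (rayleighMeasure_pos h₂ hW hy (hpos _ hxy).2).ne'

end StrictContainment

/-! ### Memoryless channels and ergodicity of the shift. -/

section Bernoulli

open ProbabilityTheory

/-- The one-sided Bernoulli shift is ergodic. -/
lemma ergodic_shift_infinitePi {X : Type*} [MeasurableSpace X] (ν : Measure X)
    [IsProbabilityMeasure ν] :
    Ergodic (fun (x : ℕ → X) (t : ℕ) => x (t + 1)) (Measure.infinitePi fun _ => ν) := by
  set T : (ℕ → X) → (ℕ → X) := fun x t => x (t + 1) with hT
  have hmp : MeasurePreserving T (Measure.infinitePi fun _ => ν) (Measure.infinitePi fun _ => ν) :=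
    ⟨by fun_prop, Measure.map_infinitePi_infinitePi_of_inj (add_left_injective 1)⟩
  refine ⟨hmp, ⟨fun s hs hTs => ?_⟩⟩
  have hind : iIndep (fun n : ℕ => MeasurableSpace.comap (fun x : ℕ → X => x n) inferInstance)
      (Measure.infinitePi fun _ => ν) :=
    (iIndepFun_infinitePi (X := fun _ => id) fun _ => measurable_id).iIndep
  have hiter (n : ℕ) (x : ℕ → X) : T^[n] x = fun t => x (t + n) := by
    induction n generalizing x with
    | zero => rfl
    | succ n ih =>
      rw [Function.iterate_succ_apply, ih]
      funext t
      simp only [hT]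
      congr 1
  -- A shift-invariant set equals its preimage under the `n`-fold shift, so it depends only on
  -- coordinates from `n` on, for every `n`. It is a tail event, and Kolmogorov's zero-one law
  -- applies.
  have htail : MeasurableSet[limsup
      (fun n : ℕ => MeasurableSpace.comap (fun x : ℕ → X => x n) inferInstance) atTop] s := by
    rw [limsup_eq_iInf_iSup_of_nat, MeasurableSpace.measurableSet_iInf]
    intro n
    have hsn : T^[n] ⁻¹' s = s := Function.IsFixedPt.preimage_iterate hTs n
    rw [← hsn]
    have hmeas : @Measurable _ _ (⨆ i, ⨆ (_ : i ≥ n),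
        MeasurableSpace.comap (fun x : ℕ → X => x i) inferInstance) _ T^[n] := by
      refine @measurable_pi_lambda _ _ _ (_) _ _ fun t => ?_
      simp only [hiter]
      exact measurable_iff_comap_le.mpr (le_iSup₂_of_le (t + n) (Nat.le_add_left n t) le_rfl)
    exact hmeas hs
  rcases measure_zero_or_one_of_measurableSet_limsup_atTop
    (fun n => (measurable_pi_apply n).comap_le) hind htail with h | h
  · exact eventuallyConst_set'.mpr (.inl (ae_eq_empty.mpr h))
  · exact eventuallyConst_set'.mpr (.inr (ae_eq_univ.mpr ((prob_compl_eq_zero_iff hs).mpr h)))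

/-- The memoryless fading channel with a given distribution of the gains. -/
def FadingChannel.iid (ν : Measure (ℝ × ℝ)) [IsProbabilityMeasure ν]
    (hν : ∀ᵐ h ∂ν, 0 ≤ h.1 ∧ 0 ≤ h.2) : FadingChannel where
  law := Measure.infinitePi fun _ => ν
  isProbabilityMeasure := inferInstance
  ergodic := ergodic_shift_infinitePi ν
  gain_nonneg := ae_all_iff.mpr fun t =>
    (measurePreserving_eval_infinitePi (fun _ : ℕ => ν) t).quasiMeasurePreserving.ae hν

lemma FadingChannel.gainLaw_iid (ν : Measure (ℝ × ℝ)) [IsProbabilityMeasure ν]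
    (hν : ∀ᵐ h ∂ν, 0 ≤ h.1 ∧ 0 ≤ h.2) : (FadingChannel.iid ν hν).gainLaw = ν :=
  Measure.infinitePi_map_eval (fun _ : ℕ => ν) 0

end Bernoulli

/-! ### The two-state on/off network. -/

section OnOff

/-- The law that takes two values with probability `1/2` each. -/
def coinFlip (s s' : ℝ × ℝ) : Measure (ℝ × ℝ) :=
  (2⁻¹ : ℝ≥0∞) • Measure.dirac s + (2⁻¹ : ℝ≥0∞) • Measure.dirac s'

lemma coinFlip_comm (s s' : ℝ × ℝ) : coinFlip s s' = coinFlip s' s := add_comm _ _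

instance (s s' : ℝ × ℝ) : IsProbabilityMeasure (coinFlip s s') :=
  ⟨by simp [coinFlip, ENNReal.inv_two_add_inv_two]⟩

lemma ae_coinFlip_iff {s s' : ℝ × ℝ} {p : ℝ × ℝ → Prop} :
    (∀ᵐ h ∂coinFlip s s', p h) ↔ p s ∧ p s' := by
  simp [coinFlip, ae_add_measure_iff, ae_dirac_eq]

lemma coinFlip_real_singleton {s s' : ℝ × ℝ} (h : s ≠ s') : (coinFlip s s').real {s} = 1 / 2 := by
  simp [coinFlip, Measure.real, h.symm]

/-- The dominating function is `K` in state `s` and zero in the other. Taking `K = 0` yields sign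
constraints on the average rates. -/
lemma apply_le_of_gainLaw_eq_coinFlip {c : FadingChannel} {C : ℝ × ℝ → Set (ℝ × ℝ)}
    {S : Set (ℝ × ℝ)} (hS : Bornology.IsBounded S) (hCS : ∀ h, C h ⊆ S) (φ : ℝ × ℝ →L[ℝ] ℝ)
    {s s' : ℝ × ℝ} (hne : s ≠ s') (hc : c.gainLaw = coinFlip s s') {K : ℝ}
    (hs : ∀ r ∈ C s, φ r ≤ K) (hs' : ∀ r ∈ C s', φ r ≤ 0) {ρ : ℝ × ℝ}
    (hρ : ρ ∈ averageRateRegion c C) : φ ρ ≤ K / 2 := by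
  have hle := apply_le_integral_of_mem_averageRateRegion hS hCS φ
    (g := ({s} : Set (ℝ × ℝ)).indicator fun _ => K)
    ((integrable_const K).indicator (measurableSet_singleton s)) ?_ hρ
  · rw [integral_indicator_const _ (measurableSet_singleton s), hc, coinFlip_real_singleton hne,
      smul_eq_mul] at hle
    linarith
  · rw [hc, ae_coinFlip_iff]
    exact ⟨by simpa using hs, by simpa [hne.symm] using hs'⟩

/-- Thin the service of each user by the seed: user 1 is served in state `s` when the seed is below
`u`, user 2 in state `s'` when it is below `v`. The states differ, so the users never compete. The
guards `u ≠ 0` and `v ≠ 0` accommodate a user without power. -/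
lemma mem_averageRateRegion_of_gainLaw_eq_coinFlip {c : FadingChannel}
    {C : ℝ × ℝ → Set (ℝ × ℝ)} (hC : ∀ h, 0 ∈ C h) {s s' : ℝ × ℝ} (hne : s ≠ s')
    (hc : c.gainLaw = coinFlip s s') {R : ℝ} {u v : unitInterval}
    (hs : u ≠ 0 → (R, 0) ∈ C s) (hs' : v ≠ 0 → (0, R) ∈ C s') :
    (u * (R / 2), v * (R / 2)) ∈ averageRateRegion c C := by
  have hm (x : ℝ × ℝ) (w : unitInterval) :
      MeasurableSet (({x} : Set (ℝ × ℝ)) ×ˢ Set.Iio w) :=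
    (measurableSet_singleton x).prod measurableSet_Iio
  have hmeas (x : ℝ × ℝ) (w : unitInterval) :
      Measurable ((({x} : Set (ℝ × ℝ)) ×ˢ Set.Iio w).indicator fun _ => R) :=
    measurable_const.indicator (hm x w)
  have hint (x : ℝ × ℝ) (w : unitInterval) :
      Integrable ((({x} : Set (ℝ × ℝ)) ×ˢ Set.Iio w).indicator fun _ => R)
        (c.gainLaw.prod volume) :=
    (integrable_const R).indicator (hm x w)
  have hval (x : ℝ × ℝ) (w : unitInterval) (hx : c.gainLaw.real {x} = 1 / 2) :
      ∫ z, (({x} : Set (ℝ × ℝ)) ×ˢ Set.Iio w).indicator (fun _ => R) z ∂(c.gainLaw.prod volume) =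
        w * (R / 2) := by
    rw [integral_indicator_const _ (hm x w), measureReal_prod_prod, hx, Measure.real,
      unitInterval.volume_Iio, ENNReal.toReal_ofReal w.2.1, smul_eq_mul]
    ring
  have := integral_mem_averageRateRegion c (C := C)
    (f := fun z => ((({s} : Set (ℝ × ℝ)) ×ˢ Set.Iio u).indicator (fun _ => R) z,
      (({s'} : Set (ℝ × ℝ)) ×ˢ Set.Iio v).indicator (fun _ => R) z))
    ((hmeas s u).prodMk (hmeas s' v)) ?_
  · rwa [integral_pair (hint s u) (hint s' v), hval s u (by rw [hc, coinFlip_real_singleton hne]),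
      hval s' v (by rw [hc, coinFlip_comm, coinFlip_real_singleton hne.symm])] at this
  · rintro ⟨h, w⟩
    by_cases h₁ : h = s ∧ w < u
    · obtain ⟨rfl, hw⟩ := h₁
      simpa [Set.indicator_apply, hw, hne] using hs ((unitInterval.nonneg' (t := w)).trans_lt hw).ne'
    · by_cases h₂ : h = s' ∧ w < v
      · obtain ⟨rfl, hw⟩ := h₂
        simpa [Set.indicator_apply, hw, hne.symm] using hs' ((unitInterval.nonneg' (t := w)).trans_lt hw).ne'
      · simpa [Set.indicator_apply, h₁, h₂, ← Prod.zero_eq_mk] using hC h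

lemma exists_unitInterval_mul_eq {K x : ℝ} (hx : x ∈ Set.Icc 0 K) :
    ∃ u : unitInterval, u * K = x := by
  rcases (hx.1.trans hx.2).eq_or_lt with rfl | hK
  · exact ⟨0, by simp [le_antisymm hx.2 hx.1]⟩
  · exact ⟨⟨x / K, div_nonneg hx.1 hK.le, (div_le_one hK).mpr hx.2⟩, div_mul_cancel₀ _ hK.ne'⟩

namespace BCNetwork.IsOnOff

variable {B : BCNetwork} {a b P R₀ : ℝ}

lemma ne (hB : B.IsOnOff a b P R₀) : (a, b) ≠ (b, a) := fun h =>
  hB.off_lt_on.ne' (congrArg Prod.fst h)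

lemma gainLaw_eq (hB : B.IsOnOff a b P R₀) : B.channel.gainLaw = coinFlip (a, b) (b, a) :=
  hB.gainLaw

lemma on_pos (hB : B.IsOnOff a b P R₀) : 0 < a := hB.off_nonneg.trans_lt hB.off_lt_on

lemma linkRate_off_lt (hB : B.IsOnOff a b P R₀) (hP : 0 < P) : linkRate b P < R₀ := by
  have := hB.off_nonneg
  rw [← hB.rate_eq]
  exact linkRate_lt_linkRate hP.le (by gcongr; exact hB.off_lt_on)

lemma rate_pos (hB : B.IsOnOff a b P R₀) (hP : 0 < P) : 0 < R₀ :=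
  (linkRate_nonneg hP.le).trans_lt (hB.linkRate_off_lt hP)

lemma mem_Icc_of_mem (hB : B.IsOnOff a b P R₀) (hP : 0 < P) {r : ℝ} (hr : r ∈ B.rates) :
    r ∈ Set.Icc 0 R₀ := by
  have := (hB.rate_pos hP).le
  rw [hB.rates, Finset.mem_insert, Finset.mem_singleton] at hr
  rcases hr with rfl | rfl <;> simp [this]

lemma eq_zero_of_mem (hB : B.IsOnOff a b P R₀) {r : ℝ} (hr : r ∈ B.rates) (hlt : r < R₀) :
    r = 0 := by
  rw [hB.rates, Finset.mem_insert, Finset.mem_singleton] at hr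
  exact hr.resolve_right hlt.ne

lemma rate_mem (hB : B.IsOnOff a b P R₀) : R₀ ∈ B.rates := by simp [hB.rates]

/-- In each state only the user with gain `a` can reach `R₀`, and giving it all the power costs the
other user nothing. Hence the region is a full square, with no tradeoff. -/
lemma stabilityRegion_eq (hB : B.IsOnOff a b P R₀) (hP : 0 < P) :
    B.stabilityRegion = Set.Icc 0 (R₀ / 2) ×ˢ Set.Icc 0 (R₀ / 2) := by
  have hbdd := (B.rates ×ˢ B.rates).finite_toSet.isBounded
  have hoff₁ {r : ℝ × ℝ} (hr : r ∈ B.supportedRates (b, a)) : r.1 = 0 :=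
    hB.eq_zero_of_mem hr.1 ((supportedRates_le hr).1.trans_lt
      (hB.peakPower ▸ hB.linkRate_off_lt hP))
  have hoff₂ {r : ℝ × ℝ} (hr : r ∈ B.supportedRates (a, b)) : r.2 = 0 :=
    hB.eq_zero_of_mem hr.2.1 ((supportedRates_le hr).2.trans_lt
      (hB.peakPower ▸ hB.linkRate_off_lt hP))
  ext ρ
  constructor
  · intro hρ
    have upper₁ := apply_le_of_gainLaw_eq_coinFlip hbdd B.supportedRates_subset (.fst ℝ ℝ ℝ) hB.ne
      hB.gainLaw_eq (fun r hr => (hB.mem_Icc_of_mem hP hr.1).2) (fun r hr => (hoff₁ hr).le) hρ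
    have upper₂ := apply_le_of_gainLaw_eq_coinFlip hbdd B.supportedRates_subset (.snd ℝ ℝ ℝ)
      hB.ne.symm (hB.gainLaw_eq.trans (coinFlip_comm _ _))
      (fun r hr => (hB.mem_Icc_of_mem hP hr.2.1).2) (fun r hr => (hoff₂ hr).le) hρ
    have lower₁ := apply_le_of_gainLaw_eq_coinFlip hbdd B.supportedRates_subset (-.fst ℝ ℝ ℝ) hB.ne
      hB.gainLaw_eq (fun r hr => neg_nonpos.mpr (hB.mem_Icc_of_mem hP hr.1).1)
      (fun r hr => neg_nonpos.mpr (hB.mem_Icc_of_mem hP hr.1).1) hρ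
    have lower₂ := apply_le_of_gainLaw_eq_coinFlip hbdd B.supportedRates_subset (-.snd ℝ ℝ ℝ) hB.ne
      hB.gainLaw_eq (fun r hr => neg_nonpos.mpr (hB.mem_Icc_of_mem hP hr.2.1).1)
      (fun r hr => neg_nonpos.mpr (hB.mem_Icc_of_mem hP hr.2.1).1) hρ
    simp at upper₁ upper₂ lower₁ lower₂
    exact ⟨⟨lower₁, upper₁⟩, ⟨lower₂, upper₂⟩⟩
  · rintro ⟨h₁, h₂⟩
    obtain ⟨u, hu⟩ := exists_unitInterval_mul_eq h₁
    obtain ⟨v, hv⟩ := exists_unitInterval_mul_eq h₂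
    have hle : R₀ ≤ linkRate a B.peakPower := by rw [hB.peakPower, hB.rate_eq]
    have := mem_averageRateRegion_of_gainLaw_eq_coinFlip B.zero_mem_supportedRates hB.ne
      hB.gainLaw_eq (u := u) (v := v) (fun _ => B.mk_zero_mem_supportedRates hB.rate_mem hle)
      (fun _ => B.zero_mk_mem_supportedRates hB.rate_mem hle)
    rwa [hu, hv] at this

/-- In a multiple access network dual to an on/off network, the first user gets no rate unless it
has the full power. -/
lemma fst_eq_zero (hB : B.IsOnOff a b P R₀) (hP : 0 < P) {M : MACNetwork} (hM : M.IsDual B)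
    (hlt : M.peakPower₁ < P) {ρ : ℝ × ℝ} (hρ : ρ ∈ M.stabilityRegion) : ρ.1 = 0 := by
  have hmem := hM.stabilityRegion_subset hρ
  rw [hB.stabilityRegion_eq hP] at hmem
  rw [hM.stabilityRegion_eq] at hρ
  -- Gain `a` reaches `R₀` exactly at power `P`, so any smaller power leaves only rate zero; gain
  -- `b` falls short even at `P`.
  have hzero {x : ℝ} (hx : x = a ∨ x = b) (y : ℝ) {r : ℝ × ℝ}
      (hr : r ∈ M.supportedRates (x, y)) : r.1 ≤ 0 := by
    refine (hB.eq_zero_of_mem (hM.rates₁ ▸ hr.1) ((M.supportedRates_le hr).1.trans_lt ?_)).le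
    rw [← hB.rate_eq]
    have ha := hB.on_pos
    rcases hx with rfl | rfl
    · exact linkRate_lt_linkRate M.peakPower₁_nonneg (by gcongr)
    · exact (linkRate_mono M.peakPower₁_nonneg hlt.le).trans_lt
        (hB.rate_eq ▸ hB.linkRate_off_lt hP)
  have := apply_le_of_gainLaw_eq_coinFlip (M.rates₁ ×ˢ M.rates₂).finite_toSet.isBounded
    M.supportedRates_subset (.fst ℝ ℝ ℝ) hB.ne hB.gainLaw_eq (K := 0)
    (fun r hr => hzero (.inl rfl) b hr) (fun r hr => hzero (.inr rfl) a hr) hρ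
  simp at this
  exact le_antisymm this hmem.1.1

/-- In a multiple access network dual to an on/off network, the second user gets no rate unless it
has the full power. -/
lemma snd_eq_zero (hB : B.IsOnOff a b P R₀) (hP : 0 < P) {M : MACNetwork} (hM : M.IsDual B)
    (hlt : M.peakPower₂ < P) {ρ : ℝ × ℝ} (hρ : ρ ∈ M.stabilityRegion) : ρ.2 = 0 := by
  have hmem := hM.stabilityRegion_subset hρ
  rw [hB.stabilityRegion_eq hP] at hmem
  rw [hM.stabilityRegion_eq] at hρ
  have hzero (x : ℝ) {y : ℝ} (hy : y = a ∨ y = b) {r : ℝ × ℝ}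
      (hr : r ∈ M.supportedRates (x, y)) : r.2 ≤ 0 := by
    refine (hB.eq_zero_of_mem (hM.rates₂ ▸ hr.2.1) ((M.supportedRates_le hr).2.trans_lt ?_)).le
    rw [← hB.rate_eq]
    have ha := hB.on_pos
    rcases hy with rfl | rfl
    · exact linkRate_lt_linkRate M.peakPower₂_nonneg (by gcongr)
    · exact (linkRate_mono M.peakPower₂_nonneg hlt.le).trans_lt
        (hB.rate_eq ▸ hB.linkRate_off_lt hP)
  have := apply_le_of_gainLaw_eq_coinFlip (M.rates₁ ×ˢ M.rates₂).finite_toSet.isBounded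
    M.supportedRates_subset (.snd ℝ ℝ ℝ) hB.ne hB.gainLaw_eq (K := 0)
    (fun r hr => hzero a (.inr rfl) hr) (fun r hr => hzero b (.inl rfl) hr) hρ
  simp at this
  exact le_antisymm this hmem.2.1

/-- The budgets add up to `P`, so at most one user has the full power and the other is silent. Each
segment is attained by giving one user everything. -/
lemma dualUnion_eq (hB : B.IsOnOff a b P R₀) (hP : 0 < P) :
    B.dualUnion = (Set.Icc 0 (R₀ / 2) ×ˢ {0}) ∪ ({0} ×ˢ Set.Icc 0 (R₀ / 2)) := by
  ext ρ
  constructor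
  · intro hρ
    have hmem := B.dualUnion_subset hρ
    rw [hB.stabilityRegion_eq hP] at hmem
    obtain ⟨M, hM, hρM⟩ := Set.mem_iUnion₂.mp hρ
    have hsum := hM.power
    have := hB.peakPower
    rcases lt_or_ge M.peakPower₁ P with hlt | hge
    · exact .inr ⟨hB.fst_eq_zero hP hM hlt hρM, hmem.2⟩
    · exact .inl ⟨hmem.1, hB.snd_eq_zero hP hM (by linarith) hρM⟩
  · rintro (⟨h₁, h₂⟩ | ⟨h₁, h₂⟩)
    · let M : MACNetwork := ⟨B.channel, P, 0, hP.le, le_rfl, B.rates, B.rates, B.zero_mem_rates,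
        B.zero_mem_rates, B.rates_nonneg, B.rates_nonneg⟩
      have hM : M.IsDual B := ⟨by simp [M, hB.peakPower], rfl, rfl, rfl⟩
      refine Set.mem_iUnion₂.mpr ⟨M, hM, ?_⟩
      obtain ⟨u, hu⟩ := exists_unitInterval_mul_eq h₁
      have := mem_averageRateRegion_of_gainLaw_eq_coinFlip M.zero_mem_supportedRates hB.ne
        hB.gainLaw_eq (u := u) (v := 0)
        (fun _ => M.mk_zero_mem_supportedRates hB.rate_mem hB.rate_eq.ge) (by simp)
      rw [hu] at this
      rwa [hM.stabilityRegion_eq,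
        show ρ = (ρ.1, 0 * (R₀ / 2)) from Prod.ext rfl (by simpa using h₂)]
    · let M : MACNetwork := ⟨B.channel, 0, P, le_rfl, hP.le, B.rates, B.rates, B.zero_mem_rates,
        B.zero_mem_rates, B.rates_nonneg, B.rates_nonneg⟩
      have hM : M.IsDual B := ⟨by simp [M, hB.peakPower], rfl, rfl, rfl⟩
      refine Set.mem_iUnion₂.mpr ⟨M, hM, ?_⟩
      obtain ⟨v, hv⟩ := exists_unitInterval_mul_eq h₂
      have := mem_averageRateRegion_of_gainLaw_eq_coinFlip M.zero_mem_supportedRates hB.ne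
        hB.gainLaw_eq (u := 0) (v := v) (by simp)
        (fun _ => M.zero_mk_mem_supportedRates hB.rate_mem hB.rate_eq.ge)
      rw [hv] at this
      rwa [hM.stabilityRegion_eq,
        show ρ = (0 * (R₀ / 2), ρ.2) from Prod.ext (by simpa using h₁) rfl]

lemma dualUnion_ssubset (hB : B.IsOnOff a b P R₀) (hP : 0 < P) :
    B.dualUnion ⊂ B.stabilityRegion := by
  refine ⟨B.dualUnion_subset, fun hsub => ?_⟩
  have hR := half_pos (hB.rate_pos hP)
  -- The corner of the square has both coordinates positive, so it lies on neither axis.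
  have hmem : (R₀ / 2, R₀ / 2) ∈ B.dualUnion := hsub <| by
    rw [hB.stabilityRegion_eq hP]
    exact ⟨⟨hR.le, le_rfl⟩, ⟨hR.le, le_rfl⟩⟩
  rw [hB.dualUnion_eq hP] at hmem
  rcases hmem with ⟨-, h⟩ | ⟨h, -⟩ <;> exact hR.ne' h

end BCNetwork.IsOnOff

/-- Independent fair coin flips supply a stationary ergodic process with the prescribed one-slot
law. -/
lemma BCNetwork.exists_isOnOff {a b P : ℝ} (hb : 0 ≤ b) (hba : b < a) (hP : 0 ≤ P) :
    ∃ B : BCNetwork, B.IsOnOff a b P (linkRate a P) := by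
  have ha := hb.trans hba.le
  have hν : ∀ᵐ h ∂coinFlip (a, b) (b, a), 0 ≤ h.1 ∧ 0 ≤ h.2 :=
    ae_coinFlip_iff.mpr ⟨⟨ha, hb⟩, ⟨hb, ha⟩⟩
  refine ⟨⟨FadingChannel.iid _ hν, P, hP, {0, linkRate a P}, by simp, ?_⟩,
    FadingChannel.gainLaw_iid _ hν, rfl, rfl, hb, hba, rfl⟩
  simp [linkRate_nonneg hP]

end OnOff

end

theorem theorem2 :
    -- at every channel state a broadcast network supports what its dual networks support
    (∀ (B : BCNetwork) (M : MACNetwork), M.IsDual B →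
      ∀ h : ℝ × ℝ, 0 ≤ h.1 → 0 ≤ h.2 → M.supportedRates h ⊆ B.supportedRates h) ∧
    -- containment, for every broadcast network
    (∀ B : BCNetwork, B.dualUnion ⊆ B.stabilityRegion) ∧
    -- strict containment, for every nondegenerate Rayleigh fading broadcast network
    (∀ (B : BCNetwork) (σ₁ σ₂ : ℝ), 0 < σ₁ → 0 < σ₂ →
      B.channel.gainLaw = (rayleighMeasure σ₁).prod (rayleighMeasure σ₂) →
      0 < B.peakPower → (∃ R ∈ B.rates, 0 < R) →
      B.dualUnion ⊂ B.stabilityRegion) ∧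
    -- more generally, whenever the gains charge every nonempty open set in the positive quadrant
    (∀ B : BCNetwork,
      (∀ U : Set (ℝ × ℝ), IsOpen U → U.Nonempty → (∀ h ∈ U, 0 < h.1 ∧ 0 < h.2) →
        0 < B.channel.gainLaw U) →
      0 < B.peakPower → (∃ R ∈ B.rates, 0 < R) →
      B.dualUnion ⊂ B.stabilityRegion) ∧
    -- strict containment for the two-state on/off networks, with the two regions
    (∀ a b P R₀ : ℝ, 0 ≤ b → b < a → 0 < P → linkRate a P = R₀ →
      (∃ B : BCNetwork, B.IsOnOff a b P R₀) ∧
      ∀ B : BCNetwork, B.IsOnOff a b P R₀ →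
        B.stabilityRegion = Set.Icc 0 (R₀ / 2) ×ˢ Set.Icc 0 (R₀ / 2) ∧
        B.dualUnion = (Set.Icc 0 (R₀ / 2) ×ˢ {0}) ∪ ({0} ×ˢ Set.Icc 0 (R₀ / 2)) ∧
        B.dualUnion ⊂ B.stabilityRegion) := by
  refine ⟨fun B M hM h h₁ h₂ => hM.supportedRates_subset h₁ h₂, BCNetwork.dualUnion_subset,
    fun B σ₁ σ₂ h₁ h₂ hlaw => BCNetwork.dualUnion_ssubset_of_gainLaw_pos fun U hU hne hpos =>
      hlaw ▸ rayleighMeasure_prod_pos h₁ h₂ hU hne hpos,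
    fun B => BCNetwork.dualUnion_ssubset_of_gainLaw_pos, fun a b P R₀ hb hba hP hR => ⟨?_, ?_⟩⟩
  · exact hR ▸ BCNetwork.exists_isOnOff hb hba hP.le
  · exact fun B hB => ⟨hB.stabilityRegion_eq hP, hB.dualUnion_eq hP, hB.dualUnion_ssubset hP⟩
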